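/- Let $d \in \mathbb{N}$ and let $X \subset \mathbb{R}^d$ be a closed Euclidean ball of positive radius. For $\boldsymbol{\gamma} = (\gamma_1, \ldots, \gamma_d) \in (0,1]^d$ let $H_{\boldsymbol{\gamma}}$ be the reproducing kernel Hilbert space over $X$ of the anisotropic Gaussian kernel $$k_{\boldsymbol{\gamma}}(x, x') = \exp\Bigl( - \sum_{j=1}^d \frac{|x_j - x_j'|^2}{\gamma_j^2} \Bigr), \qquad x, x' \in X,$$ let $\ell_\infty(X)$ be the space of all bounded functions $X \to \mathbb{R}$ with the supremum norm, and let $\mathrm{id} : H_{\boldsymbol{\gamma}} \to \ell_\infty(X)$ be the embedding. For a bounded linear operator $S : E \to F$ between normed spaces with closed unit balls $B_E$, $B_F$ and an integer $i \geq 1$, the $i$-th (dyadic) entropy number is $$e_i(S) := \inf\Bigl\{ \varepsilon > 0 : \exists\, t_1, \ldots, t_{2^{i-1}} \in S B_E \text{ such that } S B_E \subset \bigcup_{j=1}^{2^{i-1}} (t_j + \varepsilon B_F) \Bigr\}, \qquad \inf \emptyset := \infty.$$ Then there exists a constant $K > 0$ such that, for all $p \in (0,1)$, all $\boldsymbol{\gamma}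 \in (0,1]^d$ and all integers $i \geq 1$, $$e_i\bigl( \mathrm{id} : H_{\boldsymbol{\gamma}} \to \ell_\infty(X) \bigr) \leq (3K)^{\frac1p} \Bigl( \frac{d+1}{e\,p} \Bigr)^{\frac{d+1}{p}} \Bigl( \prod_{j=1}^d \gamma_j \Bigr)^{-\frac1p} i^{-\frac1p}.$$ -/

import Mathlib

open scoped ENNReal

noncomputable section

namespace AnisotropicGaussian

/-- The anisotropic Gaussian kernel with multi-bandwidth `γ` on `ℝ^d`:
`k_γ(x, y) = exp (-∑ j, |x j - y j|² / γ j ²)`. -/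
def gaussKernel {d : ℕ} (γ : Fin d → ℝ) (x y : EuclideanSpace ℝ (Fin d)) : ℝ :=
  Real.exp (-∑ j, |x j - y j| ^ 2 / γ j ^ 2)

/-- The kernel `k_γ` restricted to `X × X`, in the form used by Mathlib's reproducing kernel
Hilbert spaces: the scalar `k_γ(x, y)` acts on `ℝ` by multiplication. -/
def gaussKernelMatrix {d : ℕ} (γ : Fin d → ℝ) (X : Set (EuclideanSpace ℝ (Fin d))) :
    Matrix X X (ℝ →L[ℝ] ℝ) :=
  Matrix.of fun x y : X => gaussKernel γ x y • ContinuousLinearMap.id ℝ ℝ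

theorem gaussKernel_comm {d : ℕ} (γ : Fin d → ℝ) (x y : EuclideanSpace ℝ (Fin d)) :
    gaussKernel γ x y = gaussKernel γ y x := by
  simp only [gaussKernel, abs_sub_comm]

theorem gaussKernel_self {d : ℕ} (γ : Fin d → ℝ) (x : EuclideanSpace ℝ (Fin d)) :
    gaussKernel γ x x = 1 := by
  simp [gaussKernel]

open ProbabilityTheory in
theorem gaussKernel_eq_integral {d : ℕ} (γ : Fin d → ℝ) :
    ∃ u : EuclideanSpace ℝ (Fin d) → EuclideanSpace ℝ (Fin d),
      ∀ x y, gaussKernel γ x y =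
        ∫ z, (Real.cos (inner ℝ z (u x)) * Real.cos (inner ℝ z (u y)) +
          Real.sin (inner ℝ z (u x)) * Real.sin (inner ℝ z (u y)))
          ∂(stdGaussian (EuclideanSpace ℝ (Fin d))) := by
  refine ⟨fun x => WithLp.toLp 2 fun j => √2 * (x j / γ j), fun x y => ?_⟩
  set u : EuclideanSpace ℝ (Fin d) → EuclideanSpace ℝ (Fin d) :=
    fun x => WithLp.toLp 2 fun j => √2 * (x j / γ j) with hu
  have h := charFun_stdGaussian (E := EuclideanSpace ℝ (Fin d)) (u x - u y)
  have hn : ‖u x - u y‖ ^ 2 = 2 * ∑ j, |x j - y j| ^ 2 / γ j ^ 2 := by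
    rw [EuclideanSpace.real_norm_sq_eq, Finset.mul_sum]
    refine Finset.sum_congr rfl fun j _ => ?_
    simp only [hu, PiLp.sub_apply, sq_abs]
    rw [← mul_sub, mul_pow, Real.sq_sqrt (by norm_num), ← sub_div, div_pow]
  have hre := congrArg Complex.re h
  rw [MeasureTheory.charFun_apply] at hre
  have hint : MeasureTheory.Integrable
      (fun z => Complex.exp ((inner ℝ z (u x - u y) : ℝ) * Complex.I))
      (stdGaussian (EuclideanSpace ℝ (Fin d))) := by
    refine MeasureTheory.Integrable.of_bound (C := 1) (by fun_prop) ?_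
    filter_upwards with z
    rw [Complex.norm_exp_ofReal_mul_I]
  have hre2 := integral_re hint
  simp only [RCLike.re_to_complex] at hre2
  rw [← hre2] at hre
  have hr : (Complex.exp (-(‖u x - u y‖ : ℂ) ^ 2 / 2)).re = gaussKernel γ x y := by
    rw [gaussKernel, ← Complex.ofReal_pow, hn, ← Complex.exp_ofReal_re]
    congr 2
    push_cast
    ring
  rw [hr] at hre
  rw [← hre]
  congr 1
  ext z
  rw [Complex.exp_ofReal_mul_I_re, inner_sub_right, Real.cos_sub]

open ProbabilityTheory in
theorem gaussKernel_sum_nonneg {d : ℕ} (γ : Fin d → ℝ) {ι : Type*} (s : Finset ι)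
    (a : ι → ℝ) (x : ι → EuclideanSpace ℝ (Fin d)) :
    0 ≤ ∑ i ∈ s, ∑ j ∈ s, a i * a j * gaussKernel γ (x i) (x j) := by
  obtain ⟨u, hu⟩ := gaussKernel_eq_integral γ
  have hint : ∀ i j, MeasureTheory.Integrable
      (fun z => a i * a j * (Real.cos (inner ℝ z (u (x i))) * Real.cos (inner ℝ z (u (x j))) +
          Real.sin (inner ℝ z (u (x i))) * Real.sin (inner ℝ z (u (x j)))))
      (stdGaussian (EuclideanSpace ℝ (Fin d))) := by
    intro i j
    refine MeasureTheory.Integrable.const_mul ?_ _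
    refine MeasureTheory.Integrable.of_bound (C := 1) (by fun_prop) ?_
    filter_upwards with z
    rw [← Real.cos_sub]
    exact Real.abs_cos_le_one _
  simp_rw [hu, ← MeasureTheory.integral_const_mul]
  have h1 : ∀ i, ∑ j ∈ s, ∫ z, a i * a j *
        (Real.cos (inner ℝ z (u (x i))) * Real.cos (inner ℝ z (u (x j))) +
          Real.sin (inner ℝ z (u (x i))) * Real.sin (inner ℝ z (u (x j))))
          ∂(stdGaussian (EuclideanSpace ℝ (Fin d))) = ∫ z, ∑ j ∈ s, a i * a j *
        (Real.cos (inner ℝ z (u (x i))) * Real.cos (inner ℝ z (u (x j))) +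
          Real.sin (inner ℝ z (u (x i))) * Real.sin (inner ℝ z (u (x j))))
          ∂(stdGaussian (EuclideanSpace ℝ (Fin d))) := fun i =>
    (MeasureTheory.integral_finsetSum _ fun j _ => hint i j).symm
  simp_rw [h1]
  rw [← MeasureTheory.integral_finsetSum _ fun i _ =>
    MeasureTheory.integrable_finsetSum _ fun j _ => hint i j]
  refine MeasureTheory.integral_nonneg fun z => ?_
  have : (∑ i ∈ s, ∑ j ∈ s, a i * a j *
        (Real.cos (inner ℝ z (u (x i))) * Real.cos (inner ℝ z (u (x j))) +
          Real.sin (inner ℝ z (u (x i))) * Real.sin (inner ℝ z (u (x j))))) =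
      (∑ i ∈ s, a i * Real.cos (inner ℝ z (u (x i)))) ^ 2 +
      (∑ i ∈ s, a i * Real.sin (inner ℝ z (u (x i)))) ^ 2 := by
    rw [sq, sq, Finset.sum_mul_sum, Finset.sum_mul_sum, ← Finset.sum_add_distrib]
    refine Finset.sum_congr rfl fun i _ => ?_
    rw [← Finset.sum_add_distrib]
    exact Finset.sum_congr rfl fun j _ => by ring
  show 0 ≤ _
  rw [this]
  positivity

/-- The anisotropic Gaussian kernel is positive semidefinite. -/
instance gaussKernelMatrix_posSemidef {d : ℕ} (γ : Fin d → ℝ)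
    (X : Set (EuclideanSpace ℝ (Fin d))) : Fact (gaussKernelMatrix γ X).PosSemidef := by
  have htfae := (RKHS.posSemidef_tfae (K := gaussKernelMatrix γ X)).out 0 2
  refine ⟨htfae.mpr ⟨?_, fun v => ?_⟩⟩
  · have hs : star (ContinuousLinearMap.id ℝ ℝ) = ContinuousLinearMap.id ℝ ℝ :=
      star_one (ℝ →L[ℝ] ℝ)
    ext x y
    simp [hs, gaussKernelMatrix, gaussKernel_comm γ (y : EuclideanSpace ℝ (Fin d)) x]
  · have h := gaussKernel_sum_nonneg γ v.support v (fun x : X => (x : EuclideanSpace ℝ (Fin d)))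
    simp only [Finsupp.sum, gaussKernelMatrix, RCLike.re_to_real]
    convert h using 4 with x _ y _
    simp [gaussKernel_comm γ (y : EuclideanSpace ℝ (Fin d)) x]
    ring

/-- `H_γ`: the reproducing kernel Hilbert space over `X` of the anisotropic Gaussian kernel
`k_γ`. Its elements are functions `X → ℝ` through the coercion provided by `RKHS`. -/
abbrev GaussRKHS {d : ℕ} (γ : Fin d → ℝ) (X : Set (EuclideanSpace ℝ (Fin d))) : Type :=
  RKHS.OfKernel (gaussKernelMatrix γ X)

theorem GaussRKHS.norm_apply_le {d : ℕ} {γ : Fin d → ℝ} {X : Set (EuclideanSpace ℝ (Fin d))}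
    (f : GaussRKHS γ X) (x : X) : ‖f x‖ ≤ ‖f‖ := by
  have h := RKHS.norm_apply_le f x
  rw [RKHS.OfKernel.kernel_ofKernel] at h
  simpa [gaussKernelMatrix, gaussKernel_self, ContinuousLinearMap.norm_id] using h

/-- The embedding `id : H_γ → ℓ_∞(X)`, where `ℓ_∞(X)` is the space of all bounded functions
on `X` with the supremum norm. -/
def idToLinfty {d : ℕ} (γ : Fin d → ℝ) (X : Set (EuclideanSpace ℝ (Fin d))) :
    GaussRKHS γ X →L[ℝ] lp (fun _ : X => ℝ) ∞ :=
  LinearMap.mkContinuous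
    { toFun := fun f => ⟨fun x => f x, memℓp_infty
        ⟨‖f‖, by rintro _ ⟨x, rfl⟩; exact GaussRKHS.norm_apply_le f x⟩⟩
      map_add' := fun f g => by ext x; simp; rfl
      map_smul' := fun c f => by ext x; simp }
    1 fun f => lp.norm_le_of_forall_le (by positivity) fun x => by
      simpa using GaussRKHS.norm_apply_le f x

theorem idToLinfty_apply {d : ℕ} (γ : Fin d → ℝ) (X : Set (EuclideanSpace ℝ (Fin d)))
    (f : GaussRKHS γ X) (x : X) : idToLinfty γ X f x = f x := rfl

/-- The `i`-th (dyadic) entropy number, `i ≥ 1`, of a bounded linear operator `S : E → F`: the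
infimum of all `ε > 0` such that `S B_E` is covered by `2^(i-1)` closed balls of radius `ε`
with centres in `S B_E`, where `B_E` is the closed unit ball. It is `∞` if there is no such
`ε`. -/
def entropyNumber {E F : Type*} [NormedAddCommGroup E] [NormedSpace ℝ E]
    [NormedAddCommGroup F] [NormedSpace ℝ F] (S : E →L[ℝ] F) (i : ℕ) : ℝ≥0∞ :=
  sInf (ENNReal.ofReal '' {ε : ℝ | 0 < ε ∧ ∃ t : Fin (2 ^ (i - 1)) → F,
    (∀ j, t j ∈ S '' Metric.closedBall 0 1) ∧
    S '' Metric.closedBall 0 1 ⊆ ⋃ j, Metric.closedBall (t j) ε})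

end AnisotropicGaussian

end

noncomputable section

namespace AnisotropicGaussian

open Finset Filter Topology

/-! The rescaled Gaussian kernel has a feature expansion `∑ φ_α(u) φ_α(v)` by tensor powers of a
one-dimensional system. An `f` in the unit ball is uniformly close to a finite kernel expansion. Its
feature coefficients `b_α` have square sum equal to its quadratic form, hence bounded. On a cell
with sides proportional to `γ j`, centred anywhere, the kernel tail is geometrically small, so by
Cauchy–Schwarz `n ^ d` coefficients describe `f` up to an error of order `8 ^ (-n / 2)`
(`exists_cell_approx`).

About `∏ (γ j)⁻¹` cells cover the ball. Taking `n` of order `1 + log ε⁻¹` and rounding the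
coefficients to a grid bounds the logarithm of the number of labels by a multiple of `∏ (γ j)⁻¹ * (1
+ log ε⁻¹) ^ (d + 1)` (`exists_entropyNumber_le`).

A power of the logarithm is dominated by `ε ^ (-p)`, with the optimal constant supplied by
`pow_le_mul_exp`. This turns the logarithmic bound into the polynomial one, with `ε` equal to the
claimed right-hand side; small `i` are covered by the trivial bound `1`. -/

/-! ### Feature expansion in one dimension -/

/-- The orthonormal system `u ↦ √(2^m/m!) u^m exp(-u²)` of the one-dimensional Gaussian kernel
of bandwidth one. -/
def gaussFeature (m : ℕ) (u : ℝ) : ℝ :=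
  √(2 ^ m / (m.factorial : ℝ)) * u ^ m * Real.exp (-u ^ 2)

theorem gaussFeature_mul (m : ℕ) (u v : ℝ) :
    gaussFeature m u * gaussFeature m v =
      Real.exp (-u ^ 2 - v ^ 2) * ((2 * u * v) ^ m / (m.factorial : ℝ)) := by
  have h : √(2 ^ m / (m.factorial : ℝ)) * √(2 ^ m / (m.factorial : ℝ)) =
      2 ^ m / (m.factorial : ℝ) := Real.mul_self_sqrt (by positivity)
  calc gaussFeature m u * gaussFeature m v
      = (√(2 ^ m / (m.factorial : ℝ)) * √(2 ^ m / (m.factorial : ℝ))) * (u ^ m * v ^ m) *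
        (Real.exp (-u ^ 2) * Real.exp (-v ^ 2)) := by
        simp only [gaussFeature]; ring
    _ = _ := by
        rw [h, ← Real.exp_add, ← sub_eq_add_neg, mul_pow, mul_pow]; ring

/-- Factor the kernel as `exp (-u² - v²) * exp (2uv)` and expand the second factor in its power
series. -/
theorem hasSum_gaussFeature_mul (u v : ℝ) :
    HasSum (fun m => gaussFeature m u * gaussFeature m v) (Real.exp (-(u - v) ^ 2)) := by
  have h := (NormedSpace.expSeries_div_hasSum_exp (𝔸 := ℝ) (2 * u * v)).mul_left
    (Real.exp (-u ^ 2 - v ^ 2))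
  rw [← Real.exp_eq_exp_ℝ, ← Real.exp_add] at h
  simp_rw [gaussFeature_mul]
  rwa [show -u ^ 2 - v ^ 2 + 2 * u * v = -(u - v) ^ 2 by ring] at h

theorem sum_gaussFeature_sq_le_one (n : ℕ) (u : ℝ) :
    ∑ m ∈ range n, gaussFeature m u * gaussFeature m u ≤ 1 := by
  have h := hasSum_gaussFeature_mul u u
  simp only [sub_self, ne_eq, OfNat.ofNat_ne_zero, not_false_eq_true, zero_pow, neg_zero,
    Real.exp_zero] at h
  exact sum_le_hasSum _ (fun m _ => mul_self_nonneg _) h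

/-- The left side is the tail of a series of total mass one. Shifting the index by `n` costs a
factor `(2u²) ^ n ≤ (1/8) ^ n`, and the larger factorial only helps. -/
theorem one_sub_sum_gaussFeature_sq_le (n : ℕ) {u : ℝ} (hu : |u| ≤ 1 / 4) :
    1 - ∑ m ∈ range n, gaussFeature m u * gaussFeature m u ≤ (1 / 8) ^ n := by
  have h := hasSum_gaussFeature_mul u u
  simp only [sub_self, ne_eq, OfNat.ofNat_ne_zero, not_false_eq_true, zero_pow, neg_zero,
    Real.exp_zero] at h
  have htail := (hasSum_nat_add_iff' n).mpr h
  have hu2 : 2 * u * u ≤ 1 / 8 := by nlinarith [abs_nonneg u, sq_abs u]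
  have hu0 : 0 ≤ 2 * u * u := by nlinarith [sq_nonneg u]
  have hdom := h.mul_left ((1 / 8 : ℝ) ^ n)
  rw [mul_one] at hdom
  refine hasSum_le (fun m => ?_) htail hdom
  rw [gaussFeature_mul, gaussFeature_mul, pow_add]
  have hf : (m.factorial : ℝ) ≤ ((m + n).factorial : ℝ) := by
    exact_mod_cast Nat.factorial_le (Nat.le_add_right m n)
  have hf0 : (0 : ℝ) < m.factorial := by positivity
  have h1 : (2 * u * u) ^ m * (2 * u * u) ^ n / ((m + n).factorial : ℝ) ≤
      (2 * u * u) ^ m * (1 / 8) ^ n / (m.factorial : ℝ) := by gcongr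
  calc _ ≤ Real.exp (-u ^ 2 - u ^ 2) * ((2 * u * u) ^ m * (1 / 8) ^ n / (m.factorial : ℝ)) := by
        gcongr
    _ = _ := by ring

/-! ### Tensor products and truncation -/

/-- Multi-indices with all entries below `n`. -/
def indexBox (d n : ℕ) : Finset (Fin d → ℕ) := Fintype.piFinset fun _ => range n

theorem indexBox_mono (d : ℕ) {n N : ℕ} (h : n ≤ N) : indexBox d n ⊆ indexBox d N :=
  Fintype.piFinset_subset _ _ fun _ => range_mono h

theorem card_indexBox (d n : ℕ) : #(indexBox d n) = n ^ d := by
  simp [indexBox]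

/-- Tensor products of the functions `gaussFeature`. -/
def gaussFeatureProd {d : ℕ} (α : Fin d → ℕ) (u : Fin d → ℝ) : ℝ :=
  ∏ j, gaussFeature (α j) (u j)

theorem sum_indexBox_mul {d : ℕ} (N : ℕ) (u v : Fin d → ℝ) :
    ∑ α ∈ indexBox d N, gaussFeatureProd α u * gaussFeatureProd α v =
      ∏ j, ∑ m ∈ range N, gaussFeature m (u j) * gaussFeature m (v j) := by
  simp only [indexBox, gaussFeatureProd, ← prod_mul_distrib]
  rw [prod_univ_sum]

theorem tendsto_sum_indexBox_mul {d : ℕ} (u v : Fin d → ℝ) :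
    Tendsto (fun N => ∑ α ∈ indexBox d N, gaussFeatureProd α u * gaussFeatureProd α v) atTop
      (𝓝 (Real.exp (-∑ j, (u j - v j) ^ 2))) := by
  simp only [sum_indexBox_mul]
  rw [← sum_neg_distrib, Real.exp_sum]
  exact tendsto_finsetProd _ fun j _ => (hasSum_gaussFeature_mul (u j) (v j)).tendsto_sum_nat

theorem sum_indexBox_sq_le_one {d : ℕ} (N : ℕ) (u : Fin d → ℝ) :
    ∑ α ∈ indexBox d N, gaussFeatureProd α u * gaussFeatureProd α u ≤ 1 := by
  rw [sum_indexBox_mul]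
  exact prod_le_one (fun j _ => sum_nonneg fun m _ => mul_self_nonneg _)
    fun j _ => sum_gaussFeature_sq_le_one N (u j)

theorem one_sub_sum_indexBox_sq_le {d : ℕ} (n : ℕ) {u : Fin d → ℝ} (hu : ∀ j, |u j| ≤ 1 / 4) :
    1 - ∑ α ∈ indexBox d n, gaussFeatureProd α u * gaussFeatureProd α u ≤ d * (1 / 8) ^ n := by
  rw [sum_indexBox_mul]
  have key : ∀ s : Finset (Fin d),
      1 - ∏ j ∈ s, ∑ m ∈ range n, gaussFeature m (u j) * gaussFeature m (u j) ≤
        #s * (1 / 8) ^ n := by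
    intro s
    induction s using Finset.induction_on with
    | empty => simp
    | insert j s hj ih =>
      rw [prod_insert hj, card_insert_of_notMem hj]
      set P := ∏ j ∈ s, ∑ m ∈ range n, gaussFeature m (u j) * gaussFeature m (u j)
      have h1 := one_sub_sum_gaussFeature_sq_le n (hu j)
      have h2 := sum_gaussFeature_sq_le_one n (u j)
      have h3 : P ≤ 1 := prod_le_one (fun j _ => sum_nonneg fun m _ => mul_self_nonneg _)
        fun j _ => sum_gaussFeature_sq_le_one n (u j)
      push_cast
      -- With factors `a, b ≤ 1`, `(1 - a) * (1 - b) ≥ 0` gives `1 - a * b ≤ (1 - a) + (1 - b)`.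
      nlinarith [mul_nonneg (sub_nonneg.2 h2) (sub_nonneg.2 h3)]
  simpa using key univ

/-- Its square is one term of a sum of squares bounded by the kernel's diagonal value one. -/
theorem gaussFeatureProd_abs_le_one {d : ℕ} (α : Fin d → ℕ) (u : Fin d → ℝ) :
    |gaussFeatureProd α u| ≤ 1 := by
  have hα : α ∈ indexBox d (univ.sup α + 1) := by
    simp only [indexBox, Fintype.mem_piFinset, mem_range]
    exact fun j => Nat.lt_succ_of_le (le_sup (f := α) (mem_univ j))
  have h := single_le_sum (f := fun α => gaussFeatureProd α u * gaussFeatureProd α u)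
    (fun _ _ => mul_self_nonneg _) hα
  have h2 := h.trans (sum_indexBox_sq_le_one _ u)
  rw [abs_le_one_iff_mul_self_le_one]
  exact h2

/-- Identifies the quadratic form of a truncated kernel with the square sum of the feature
coefficients. -/
theorem sum_sum_mul_eq_sum_sq {ι κ : Type*} (s : Finset ι) (t : Finset κ) (a : ι → ℝ)
    (φ : κ → ι → ℝ) :
    ∑ y ∈ s, ∑ z ∈ s, a y * a z * ∑ α ∈ t, φ α y * φ α z =
      ∑ α ∈ t, (∑ y ∈ s, a y * φ α y) ^ 2 := by
  simp_rw [sq, sum_mul_sum, mul_sum]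
  symm
  rw [sum_comm]
  refine sum_congr rfl fun y _ => ?_
  rw [sum_comm]
  exact sum_congr rfl fun z _ => sum_congr rfl fun α _ => by ring

/-- A kernel expansion of quadratic form at most `C²` is, near the origin, a combination of the
functions `gaussFeatureProd α`, `α ∈ indexBox d n`, up to a geometrically small error. -/
theorem kernel_expansion_approx {d : ℕ} {ι : Type*} (s : Finset ι) (a : ι → ℝ)
    (v : ι → Fin d → ℝ) {C : ℝ} (hC : 0 ≤ C)
    (hQ : ∑ y ∈ s, ∑ z ∈ s, a y * a z * Real.exp (-∑ j, (v y j - v z j) ^ 2) ≤ C ^ 2) (n : ℕ) :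
    ∃ b : (Fin d → ℕ) → ℝ, (∀ α, |b α| ≤ C) ∧
      ∀ u : Fin d → ℝ, (∀ j, |u j| ≤ 1 / 4) →
        |∑ y ∈ s, a y * Real.exp (-∑ j, (v y j - u j) ^ 2) -
          ∑ α ∈ indexBox d n, b α * gaussFeatureProd α u| ≤ C * √(d * (1 / 8) ^ n) := by
  set b : (Fin d → ℕ) → ℝ := fun α => ∑ y ∈ s, a y * gaussFeatureProd α (v y) with hb
  have hmono : Monotone fun N => ∑ α ∈ indexBox d N, b α ^ 2 := fun n N h =>
    sum_le_sum_of_subset_of_nonneg (indexBox_mono d h) fun _ _ _ => sq_nonneg _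
  have hlim : Tendsto (fun N => ∑ α ∈ indexBox d N, b α ^ 2) atTop
      (𝓝 (∑ y ∈ s, ∑ z ∈ s, a y * a z * Real.exp (-∑ j, (v y j - v z j) ^ 2))) := by
    simp only [hb, ← sum_sum_mul_eq_sum_sq]
    exact tendsto_finsetSum _ fun y _ => tendsto_finsetSum _ fun z _ =>
      (tendsto_sum_indexBox_mul (v y) (v z)).const_mul _
  have hbC : ∀ N, ∑ α ∈ indexBox d N, b α ^ 2 ≤ C ^ 2 := fun N =>
    (hmono.ge_of_tendsto hlim N).trans hQ
  refine ⟨b, fun α => ?_, fun u hu => ?_⟩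
  · have hα : α ∈ indexBox d (univ.sup α + 1) := by
      simp only [indexBox, Fintype.mem_piFinset, mem_range]
      exact fun j => Nat.lt_succ_of_le (le_sup (f := α) (mem_univ j))
    exact abs_le_of_sq_le_sq ((single_le_sum (f := fun α => b α ^ 2)
      (fun _ _ => sq_nonneg _) hα).trans (hbC _)) hC
  · have hlimu : Tendsto (fun N => ∑ α ∈ indexBox d N, b α * gaussFeatureProd α u) atTop
        (𝓝 (∑ y ∈ s, a y * Real.exp (-∑ j, (v y j - u j) ^ 2))) := by
      simp only [hb, sum_mul]
      simp_rw [sum_comm (t := s), mul_assoc, ← mul_sum]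
      exact tendsto_finsetSum _ fun y _ => (tendsto_sum_indexBox_mul (v y) u).const_mul _
    -- For `N ≥ n` the difference is a sum over the box `N` minus the box `n`. Cauchy–Schwarz bounds
    -- it by the coefficient norm, at most `C`, times the tail of `∑ φ_α(u)²`. Only `u` must be near
    -- the origin; the points `v y` are arbitrary.
    refine le_of_tendsto (hlimu.sub_const _).abs ?_
    filter_upwards [eventually_ge_atTop n] with N hN
    rw [← sum_sdiff (indexBox_mono d hN), add_sub_cancel_right]
    refine Real.abs_le_sqrt (sum_mul_sq_le_sq_mul_sq _ _ _) |>.trans ?_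
    rw [Real.sqrt_le_left (by positivity), mul_pow, Real.sq_sqrt (by positivity)]
    refine mul_le_mul ?_ ?_ (sum_nonneg fun _ _ => sq_nonneg _) (sq_nonneg _)
    · exact (sum_le_sum_of_subset_of_nonneg sdiff_subset fun _ _ _ => sq_nonneg _).trans (hbC N)
    · refine le_trans ?_ (one_sub_sum_indexBox_sq_le n hu)
      have h1 := sum_indexBox_sq_le_one N u
      rw [← sum_sdiff (indexBox_mono d hN)] at h1
      simp only [sq]
      linarith

/-! ### Approximation in the RKHS -/

theorem inner_kerFun_kerFun {d : ℕ} {γ : Fin d → ℝ} {X : Set (EuclideanSpace ℝ (Fin d))}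
    (x y : X) :
    inner ℝ (RKHS.kerFun (GaussRKHS γ X) x (1 : ℝ)) (RKHS.kerFun (GaussRKHS γ X) y (1 : ℝ)) =
      gaussKernel γ x y := by
  rw [RKHS.kerFun_inner, RKHS.kerFun_apply, RKHS.OfKernel.kernel_ofKernel]
  simp [gaussKernelMatrix]

/-- Elements of `H_γ` are approximated by finite kernel expansions. -/
theorem exists_kernel_expansion {d : ℕ} {γ : Fin d → ℝ} {X : Set (EuclideanSpace ℝ (Fin d))}
    (f : GaussRKHS γ X) {δ : ℝ} (hδ : 0 < δ) :
    ∃ (s : Finset X) (a : X → ℝ),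
      ∑ y ∈ s, ∑ z ∈ s, a y * a z * gaussKernel γ y z ≤ (‖f‖ + δ) ^ 2 ∧
      ∀ x : X, |f x - ∑ y ∈ s, a y * gaussKernel γ y x| ≤ δ := by
  set k : X → GaussRKHS γ X := fun x => RKHS.kerFun (GaussRKHS γ X) x (1 : ℝ) with hk
  have hle : Submodule.span ℝ {RKHS.kerFun (GaussRKHS γ X) x v | (x : X) (v : ℝ)} ≤
      Submodule.span ℝ (Set.range k) := by
    rw [Submodule.span_le]
    rintro _ ⟨x, v, rfl⟩
    have : RKHS.kerFun (GaussRKHS γ X) x v = v • k x := by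
      rw [hk, ← map_smul, smul_eq_mul, mul_one]
    rw [this]
    exact Submodule.smul_mem _ _ (Submodule.subset_span ⟨x, rfl⟩)
  have hf : f ∈ closure (Submodule.span ℝ (Set.range k) : Set (GaussRKHS γ X)) := by
    have h : f ∈ (Submodule.span ℝ
        {RKHS.kerFun (GaussRKHS γ X) x v | (x : X) (v : ℝ)}).topologicalClosure := by
      rw [RKHS.kerFun_dense]; trivial
    exact closure_mono hle h
  obtain ⟨g, hg, hfg⟩ := Metric.mem_closure_iff.1 hf δ hδ
  obtain ⟨a, rfl⟩ := Finsupp.mem_span_range_iff_exists_finsupp.1 hg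
  rw [dist_eq_norm] at hfg
  refine ⟨a.support, a, ?_, fun x => ?_⟩
  · have h1 : ‖a.sum fun i c => c • k i‖ ≤ ‖f‖ + δ := by
      have := norm_sub_norm_le (a.sum fun i c => c • k i) f
      rw [norm_sub_rev] at this
      linarith
    calc ∑ y ∈ a.support, ∑ z ∈ a.support, a y * a z * gaussKernel γ y z
        = ‖a.sum fun i c => c • k i‖ ^ 2 := by
          rw [← real_inner_self_eq_norm_sq, Finsupp.sum, sum_inner]
          refine sum_congr rfl fun y _ => ?_
          rw [inner_sum]
          refine sum_congr rfl fun z _ => ?_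
          rw [real_inner_smul_left, real_inner_smul_right, inner_kerFun_kerFun]
          ring
      _ ≤ _ := by gcongr
  · have h2 := GaussRKHS.norm_apply_le (f - a.sum fun i c => c • k i) x
    have h3 : (a.sum fun i c => c • k i) x = ∑ y ∈ a.support, a y * gaussKernel γ y x := by
      have h4 := RKHS.inner_kerFun x (1 : ℝ) (a.sum fun i c => c • k i)
      have h5 : (a.sum fun i c => c • k i) x =
          inner ℝ (a.sum fun i c => c • k i) (RKHS.kerFun (GaussRKHS γ X) x (1 : ℝ)) := by
        rw [h4]; simp
      rw [h5, Finsupp.sum, sum_inner]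
      refine sum_congr rfl fun y _ => ?_
      rw [real_inner_smul_left, inner_kerFun_kerFun]
    rw [RKHS.coe_sub, Pi.sub_apply, h3, Real.norm_eq_abs] at h2
    linarith

theorem gaussKernel_eq_scaled {d : ℕ} (γ : Fin d → ℝ) (a x y : EuclideanSpace ℝ (Fin d)) :
    gaussKernel γ x y =
      Real.exp (-∑ j, ((x j - a j) / γ j - (y j - a j) / γ j) ^ 2) := by
  rw [gaussKernel]
  congr 2
  refine sum_congr rfl fun j _ => ?_
  rw [← sub_div, sub_sub_sub_cancel_right, div_pow, sq_abs]

/-- On the cell `|x j - a j| ≤ γ j / 4` the unit ball of `H_γ` is close to an `n ^ d`-dimensional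
space of functions, with bounded coefficients. -/
theorem exists_cell_approx {d : ℕ} {γ : Fin d → ℝ} {X : Set (EuclideanSpace ℝ (Fin d))}
    {f : GaussRKHS γ X} (hf : ‖f‖ ≤ 1) {δ : ℝ} (hδ : 0 < δ) (hδ1 : δ ≤ 1) (n : ℕ)
    (hn : d * (1 / 8 : ℝ) ^ n ≤ δ ^ 2) (a : EuclideanSpace ℝ (Fin d)) :
    ∃ b : (Fin d → ℕ) → ℝ, (∀ α, |b α| ≤ 2) ∧
      ∀ x : X, (∀ j, |(x.1 j - a j) / γ j| ≤ 1 / 4) →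
        |f x - ∑ α ∈ indexBox d n, b α * gaussFeatureProd α fun j => (x.1 j - a j) / γ j| ≤
          3 * δ := by
  obtain ⟨s, w, hQ, hfw⟩ := exists_kernel_expansion f hδ
  have hQ2 : ∑ y ∈ s, ∑ z ∈ s, w y * w z * gaussKernel γ y z ≤ 2 ^ 2 :=
    hQ.trans (by gcongr; linarith)
  simp_rw [gaussKernel_eq_scaled γ a] at hQ2 hfw
  obtain ⟨b, hb, hu⟩ := kernel_expansion_approx s w (fun y j => (y.1 j - a j) / γ j) zero_le_two
    hQ2 n
  refine ⟨b, hb, fun x hx => ?_⟩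
  have h1 := hu _ hx
  have h2 : √(d * (1 / 8 : ℝ) ^ n) ≤ δ := (Real.sqrt_le_left hδ.le).2 hn
  calc _ ≤ _ := abs_sub_le _ _ _
    _ ≤ δ + 2 * δ := add_le_add (hfw x) (h1.trans (by gcongr))
    _ = 3 * δ := by ring

/-! ### From labels to entropy numbers -/

/-- If finitely many labels separate the points of the unit ball up to `ε`, then they bound the
entropy numbers. -/
theorem entropyNumber_le_of_label {E F : Type*} [NormedAddCommGroup E] [NormedSpace ℝ E]
    [NormedAddCommGroup F] [NormedSpace ℝ F] (S : E →L[ℝ] F) (i : ℕ) {ε : ℝ} (hε : 0 < ε)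
    {T : Type*} [Fintype T] (hT : Fintype.card T ≤ 2 ^ (i - 1)) (Φ : E → T)
    (hΦ : ∀ f g : E, ‖f‖ ≤ 1 → ‖g‖ ≤ 1 → Φ f = Φ g → ‖S f - S g‖ ≤ ε) :
    entropyNumber S i ≤ ENNReal.ofReal ε := by
  classical
  refine sInf_le ⟨ε, ⟨hε, ?_⟩, rfl⟩
  -- Unattained labels get the value `0`, so every representative lies in the unit ball and every
  -- centre in its image, as the definition requires.
  let rep : T → E := fun t => if h : ∃ f : E, ‖f‖ ≤ 1 ∧ Φ f = t then h.choose else 0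
  have hrep : ∀ t, ‖rep t‖ ≤ 1 := fun t => by
    by_cases h : ∃ f : E, ‖f‖ ≤ 1 ∧ Φ f = t
    · simp only [rep, dif_pos h]; exact h.choose_spec.1
    · simp [rep, dif_neg h]
  have hrepΦ : ∀ f, ‖f‖ ≤ 1 → Φ f = Φ (rep (Φ f)) := fun f hf => by
    have h : ∃ g : E, ‖g‖ ≤ 1 ∧ Φ g = Φ f := ⟨f, hf, rfl⟩
    simp only [rep, dif_pos h]; exact h.choose_spec.2.symm
  have : Nonempty T := ⟨Φ 0⟩
  obtain ⟨e⟩ : Nonempty (T ↪ Fin (2 ^ (i - 1))) :=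
    Function.Embedding.nonempty_of_card_le (by simpa using hT)
  refine ⟨fun j => S (rep (Function.invFun e j)), fun j => ⟨_, by simpa using hrep _, rfl⟩, ?_⟩
  rintro _ ⟨f, hf, rfl⟩
  have hf1 : ‖f‖ ≤ 1 := by simpa using hf
  refine Set.mem_iUnion.2 ⟨e (Φ f), ?_⟩
  beta_reduce
  rw [Function.leftInverse_invFun e.injective, Metric.mem_closedBall, dist_eq_norm]
  exact hΦ _ _ hf1 (hrep _) (hrepΦ f hf1)

/-- The kernel is one on the diagonal, so the sup norm is at most the RKHS norm and a single ball
around `0` suffices. -/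
theorem entropyNumber_le_one {d : ℕ} (γ : Fin d → ℝ) (X : Set (EuclideanSpace ℝ (Fin d)))
    (i : ℕ) : entropyNumber (idToLinfty γ X) i ≤ 1 := by
  rw [← ENNReal.ofReal_one]
  refine sInf_le ⟨1, ⟨one_pos, fun _ => 0, fun _ => ⟨0, by simp, map_zero _⟩, ?_⟩, rfl⟩
  rintro _ ⟨f, hf, rfl⟩
  have hf1 : ‖f‖ ≤ 1 := by simpa using hf
  refine Set.mem_iUnion.2 ⟨⟨0, by positivity⟩, ?_⟩
  rw [Metric.mem_closedBall, dist_zero_right]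
  exact lp.norm_le_of_forall_le zero_le_one fun x => (GaussRKHS.norm_apply_le f x).trans hf1

theorem floor_mem_Icc_neg_ceil {x y : ℝ} (h : |x| ≤ y) :
    ⌊x⌋ ∈ Icc (-(⌈y⌉₊ : ℤ)) ⌈y⌉₊ := by
  obtain ⟨h1, h2⟩ := abs_le.1 h
  have hy := Nat.le_ceil y
  rw [mem_Icc]
  constructor
  · rw [Int.le_floor]; push_cast; linarith
  · exact_mod_cast (Int.floor_le x).trans (h2.trans hy)

/-- A bound of the entropy numbers by a covering: cells of side length `γ j / 4`, and on each cell
the coefficients of an approximation rounded to a grid. -/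
theorem entropyNumber_le_of_card {d : ℕ} (c : EuclideanSpace ℝ (Fin d)) (r : ℝ)
    {γ : Fin d → ℝ} (hγ : ∀ j, 0 < γ j) {ε : ℝ} (hε : 0 < ε) (hε1 : ε ≤ 1) {n : ℕ} (hn1 : 1 ≤ n)
    (hn : d * (1 / 8 : ℝ) ^ n ≤ (ε / 9) ^ 2) {i : ℕ}
    (hi : (2 * ⌈6 * (n : ℝ) ^ d / ε⌉₊ + 1) ^ ((∏ j, (2 * ⌈4 * r / γ j⌉₊ + 1)) * n ^ d) ≤
      2 ^ (i - 1)) :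
    entropyNumber (idToLinfty γ (Metric.closedBall c r)) i ≤ ENNReal.ofReal ε := by
  classical
  set X := Metric.closedBall c r
  set cells : Finset (Fin d → ℤ) :=
    Fintype.piFinset fun j => Icc (-(⌈4 * r / γ j⌉₊ : ℤ)) ⌈4 * r / γ j⌉₊ with hcells
  set G := ⌈6 * (n : ℝ) ^ d / ε⌉₊
  -- The error budget is three times `ε / 3`: approximating `f`, approximating `g`, and rounding `n
  -- ^ d` coefficients to mesh `η`. Coefficients are at most `2`, and `2 / η` gives the grid size
  -- `G`.
  set η : ℝ := ε / (3 * (n : ℝ) ^ d) with hη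
  have hn0 : (0 : ℝ) < n := by exact_mod_cast hn1
  have hη0 : 0 < η := by positivity
  have hex : ∀ (f : GaussRKHS γ X) (k : Fin d → ℤ), ∃ b : (Fin d → ℕ) → ℝ, (∀ α, |b α| ≤ 2) ∧
      (‖f‖ ≤ 1 → ∀ x : X, (∀ j, |(x.1 j - (c j + k j * (γ j / 4))) / γ j| ≤ 1 / 4) →
        |f x - ∑ α ∈ indexBox d n, b α *
          gaussFeatureProd α fun j => (x.1 j - (c j + k j * (γ j / 4))) / γ j| ≤ ε / 3) := by
    intro f k
    by_cases hf : ‖f‖ ≤ 1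
    · obtain ⟨b, hb, h⟩ := exists_cell_approx hf (δ := ε / 9) (by positivity) (by linarith) n hn
        (WithLp.toLp 2 fun j => c j + k j * (γ j / 4))
      exact ⟨b, hb, fun _ x hx => (h x hx).trans (by linarith)⟩
    -- Outside the unit ball any bounded coefficients do; they only make the labelling total.
    · exact ⟨0, by simp, fun h => absurd h hf⟩
  choose b hb2 hbapprox using hex
  let Φ : GaussRKHS γ X → (cells × indexBox d n → Icc (-(G : ℤ)) G) := fun f q =>
    ⟨⌊b f q.1 q.2 / η⌋, floor_mem_Icc_neg_ceil (by
      rw [abs_div, abs_of_pos hη0]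
      calc |b f q.1 q.2| / η ≤ 2 / η := by gcongr; exact hb2 _ _ _
        _ = 6 * (n : ℝ) ^ d / ε := by rw [hη]; field_simp; norm_num)⟩
  refine entropyNumber_le_of_label _ i hε (le_of_eq_of_le ?_ hi) Φ fun f g hf hg hfg => ?_
  · have h1 : ∀ m : ℕ, #(Icc (-(m : ℤ)) m) = 2 * m + 1 := fun m => by
      rw [Int.card_Icc]; omega
    simp only [Fintype.card_fun, Fintype.card_prod, Fintype.card_coe, card_indexBox, hcells,
      Fintype.card_piFinset, h1]
  · refine lp.norm_le_of_forall_le hε.le fun x => ?_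
    set k : Fin d → ℤ := fun j => ⌊4 * (x.1 j - c j) / γ j⌋ with hk
    have hkmem : k ∈ cells := by
      refine Fintype.mem_piFinset.2 fun j => floor_mem_Icc_neg_ceil ?_
      rw [abs_div, abs_mul, abs_of_pos (hγ j), abs_of_pos (by norm_num : (0 : ℝ) < 4)]
      have h1 : |x.1 j - c j| ≤ r := by
        have h2 := PiLp.norm_apply_le (x.1 - c) j
        have h3 := x.2
        rw [Metric.mem_closedBall, dist_eq_norm] at h3
        rw [PiLp.sub_apply, Real.norm_eq_abs] at h2
        exact h2.trans h3
      have := hγ j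
      gcongr
    have hcell : ∀ j, |(x.1 j - (c j + k j * (γ j / 4))) / γ j| ≤ 1 / 4 := by
      intro j
      have h1 : (x.1 j - (c j + k j * (γ j / 4))) / γ j =
          (4 * (x.1 j - c j) / γ j - k j) / 4 := by
        have := (hγ j).ne'
        field_simp
        ring
      have h2 := Int.floor_le (4 * (x.1 j - c j) / γ j)
      have h3 := Int.lt_floor_add_one (4 * (x.1 j - c j) / γ j)
      rw [h1, abs_le]
      constructor <;> simp only [hk] <;> linarith
    have hf' := hbapprox f k hf x hcell
    have hg' := hbapprox g k hg x hcell
    set u : Fin d → ℝ := fun j => (x.1 j - (c j + k j * (γ j / 4))) / γ j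
    have hdiff : |∑ α ∈ indexBox d n, b f k α * gaussFeatureProd α u -
        ∑ α ∈ indexBox d n, b g k α * gaussFeatureProd α u| ≤ ε / 3 := by
      rw [← sum_sub_distrib]
      calc _ ≤ ∑ α ∈ indexBox d n, |b f k α * gaussFeatureProd α u -
            b g k α * gaussFeatureProd α u| := abs_sum_le_sum_abs _ _
        _ ≤ ∑ α ∈ indexBox d n, η := by
          refine sum_le_sum fun α hα => ?_
          have h1 : ⌊b f k α / η⌋ = ⌊b g k α / η⌋ :=
            congrArg Subtype.val (congrFun hfg (⟨k, hkmem⟩, ⟨α, hα⟩))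
          have h2 := (Int.abs_sub_lt_one_of_floor_eq_floor h1).le
          rw [← sub_div, abs_div, abs_of_pos hη0, div_le_one hη0] at h2
          rw [← sub_mul, abs_mul]
          calc _ ≤ η * 1 := mul_le_mul h2 (gaussFeatureProd_abs_le_one α u) (abs_nonneg _) hη0.le
            _ = η := mul_one η
        _ = ε / 3 := by
          rw [sum_const, card_indexBox, nsmul_eq_mul, hη]
          push_cast
          field_simp
    rw [lp.coeFn_sub, Pi.sub_apply, idToLinfty_apply, idToLinfty_apply, Real.norm_eq_abs]
    rw [abs_le] at hf' hg' hdiff ⊢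
    constructor <;> linarith

/-! ### Logarithmic entropy bound -/

/-- The metric entropy of the unit ball of `H_γ` is at most of order
`(∏ j, γ j)⁻¹ (1 + log ε⁻¹)^(d+1)`. -/
theorem exists_entropyNumber_le {d : ℕ} (c : EuclideanSpace ℝ (Fin d)) {r : ℝ} (hr : 0 < r) :
    ∃ K : ℝ, 0 < K ∧ ∀ γ : Fin d → ℝ, (∀ j, 0 < γ j ∧ γ j ≤ 1) → ∀ ε : ℝ, 0 < ε → ε ≤ 1 →
      ∀ i : ℕ, K * (∏ j, γ j)⁻¹ * (1 + Real.log ε⁻¹) ^ (d + 1) ≤ (i - 1 : ℕ) * Real.log 2 →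
        entropyNumber (idToLinfty γ (Metric.closedBall c r)) i ≤ ENNReal.ofReal ε := by
  set D : ℝ := Real.log (9 * (d + 1)) with hD
  have hD0 : 0 < D := Real.log_pos (by linarith [Nat.cast_nonneg (α := ℝ) d])
  set C : ℝ := 1 + D with hC
  set C' : ℝ := Real.log 15 + d * C + 1 with hC'
  have hlog15 : 0 < Real.log 15 := Real.log_pos (by norm_num)
  have hC0 : 0 < C := by positivity
  have hC'0 : 0 < C' := by positivity
  refine ⟨(8 * r + 3) ^ d * C ^ d * C', by positivity, fun γ hγ ε hε hε1 i hi => ?_⟩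
  set ℓ := Real.log ε⁻¹ with hℓ
  have hℓ0 : 0 ≤ ℓ := Real.log_nonneg ((one_le_inv₀ hε).2 hε1)
  have hexpℓ : Real.exp (-ℓ) = ε := by rw [hℓ, Real.log_inv, neg_neg, Real.exp_log hε]
  -- Then `exp (-n) ≤ ε / (9 * (d + 1))`; since `8 ≥ e²`, squaring gives the required smallness of
  -- `d * (1/8) ^ n`.
  set n := ⌈D + ℓ⌉₊ with hn
  have hnD : D + ℓ ≤ n := Nat.le_ceil _
  have hn1 : 1 ≤ n := Nat.one_le_ceil_iff.2 (by positivity)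
  have hn1' : (1 : ℝ) ≤ n := by exact_mod_cast hn1
  have hnC : (n : ℝ) ≤ C * (1 + ℓ) := by
    have := (Nat.ceil_lt_add_one (by positivity : 0 ≤ D + ℓ)).le
    rw [hC]
    nlinarith [mul_nonneg hD0.le hℓ0]
  have hΓ : 0 < ∏ j, γ j := prod_pos fun j _ => (hγ j).1
  refine entropyNumber_le_of_card c r (fun j => (hγ j).1) hε hε1 hn1 ?_ ?_
  · have h8 : (1 / 8 : ℝ) ≤ Real.exp (-2) := by
      rw [Real.exp_neg, one_div]
      refine inv_anti₀ (Real.exp_pos _) ?_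
      have h := Real.exp_one_lt_d9
      have h2 : Real.exp 2 = Real.exp 1 * Real.exp 1 := by rw [← Real.exp_add]; norm_num
      rw [h2]
      nlinarith [Real.exp_pos 1]
    have h1 : (1 / 8 : ℝ) ^ n ≤ (ε / (9 * (d + 1))) ^ 2 := by
      calc (1 / 8 : ℝ) ^ n ≤ Real.exp (-2) ^ n := by gcongr
        _ = Real.exp (-n) ^ 2 := by
          rw [← Real.exp_nat_mul, ← Real.exp_nat_mul]; congr 1; push_cast; ring
        _ ≤ Real.exp (-(D + ℓ)) ^ 2 := by gcongr
        _ = _ := by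
          rw [neg_add, Real.exp_add, hexpℓ, Real.exp_neg, hD, Real.exp_log (by positivity)]
          congr 1
          rw [div_eq_mul_inv, mul_comm]
    calc (d : ℝ) * (1 / 8) ^ n ≤ ((d : ℝ) + 1) ^ 2 * (ε / (9 * (d + 1))) ^ 2 := by
          gcongr
          nlinarith [(by positivity : (0 : ℝ) ≤ d)]
      _ = (ε / 9) ^ 2 := by rw [← mul_pow]; congr 1; field_simp
  -- With `t = n ^ d / ε ≥ 1`, `2 * (6 * t + 1) + 1 ≤ 15 * t`. The constant `8 * r + 3` in `hcells`
  -- arises likewise from `(γ j)⁻¹ ≥ 1`.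
  · have hgrid : ((2 * ⌈6 * (n : ℝ) ^ d / ε⌉₊ + 1 : ℕ) : ℝ) ≤ 15 * (n : ℝ) ^ d / ε := by
      have h1 := (Nat.ceil_lt_add_one (by positivity : 0 ≤ 6 * (n : ℝ) ^ d / ε)).le
      have h2 : 1 ≤ (n : ℝ) ^ d / ε := by
        rw [one_le_div hε]; exact hε1.trans (one_le_pow₀ hn1')
      push_cast
      have h3 : ∀ t : ℝ, t * (n : ℝ) ^ d / ε = t * ((n : ℝ) ^ d / ε) := fun t => mul_div_assoc _ _ _
      rw [h3] at h1
      rw [h3, h3]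
      linarith
    have hloggrid : Real.log ((2 * ⌈6 * (n : ℝ) ^ d / ε⌉₊ + 1 : ℕ) : ℝ) ≤ C' * (1 + ℓ) := by
      refine (Real.log_le_log (by positivity) hgrid).trans ?_
      rw [div_eq_mul_inv, Real.log_mul (by positivity) (by positivity),
        Real.log_mul (by positivity) (by positivity), Real.log_pow, ← hℓ]
      have h1 : Real.log n ≤ C * (1 + ℓ) := (Real.log_le_self (by positivity)).trans hnC
      have h2 : (d : ℝ) * Real.log n ≤ d * (C * (1 + ℓ)) := by gcongr
      rw [hC']
      nlinarith [mul_nonneg hlog15.le hℓ0]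
    have hcells : ((∏ j, (2 * ⌈4 * r / γ j⌉₊ + 1) : ℕ) : ℝ) ≤
        (8 * r + 3) ^ d * (∏ j, γ j)⁻¹ := by
      have : (8 * r + 3) ^ d * (∏ j, γ j)⁻¹ = ∏ j, (8 * r + 3) * (γ j)⁻¹ := by
        rw [prod_mul_distrib, prod_inv_distrib, prod_const, card_univ, Fintype.card_fin]
      rw [this]
      push_cast
      refine prod_le_prod (fun j _ => by positivity) fun j _ => ?_
      have hγj := (hγ j).1
      have h1 := (Nat.ceil_lt_add_one (by positivity : 0 ≤ 4 * r / γ j)).le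
      have h2 : 1 ≤ (γ j)⁻¹ := (one_le_inv₀ hγj).2 (hγ j).2
      rw [div_eq_mul_inv] at h1
      rw [add_mul, div_eq_mul_inv]
      linarith
    have hreal : Real.log (((2 * ⌈6 * (n : ℝ) ^ d / ε⌉₊ + 1) ^
        ((∏ j, (2 * ⌈4 * r / γ j⌉₊ + 1)) * n ^ d) : ℕ) : ℝ) ≤ Real.log ((2 ^ (i - 1) : ℕ) : ℝ) := by
      rw [Nat.cast_pow, Real.log_pow, Nat.cast_pow, Real.log_pow, Nat.cast_mul, Nat.cast_pow]
      refine le_trans ?_ (hi.trans (by norm_num))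
      calc _ ≤ ((8 * r + 3) ^ d * (∏ j, γ j)⁻¹) * (C * (1 + ℓ)) ^ d * (C' * (1 + ℓ)) := by
            gcongr
        _ = _ := by rw [mul_pow, pow_succ]; ring
    have := (Real.log_le_log_iff (by positivity) (by positivity)).1 hreal
    exact_mod_cast this

/-! ### From logarithmic to polynomial bounds -/

/-- Raise `t ≤ exp (t - 1)` at `t = p * U / (d + 1)` to the power `d + 1`. This is the source of the
factor `(d + 1) / (e * p)` in the theorem. -/
theorem pow_le_mul_exp {p U : ℝ} (hp : 0 < p) (hU : 0 ≤ U) (d : ℕ) :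
    U ^ (d + 1) ≤ (((d : ℝ) + 1) / (Real.exp 1 * p)) ^ (d + 1) * Real.exp (p * U) := by
  have hd : (0 : ℝ) < d + 1 := by positivity
  have h1 := Real.add_one_le_exp (p * U / (d + 1) - 1)
  rw [sub_add_cancel, Real.exp_sub] at h1
  have h2 : U ≤ ((d : ℝ) + 1) / (Real.exp 1 * p) * Real.exp (p * U / (d + 1)) := by
    have h3 : U = (p * U / (d + 1)) * ((d + 1) / p) := by field_simp
    calc U = (p * U / (d + 1)) * ((d + 1) / p) := h3
      _ ≤ Real.exp (p * U / (d + 1)) / Real.exp 1 * ((d + 1) / p) := by gcongr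
      _ = _ := by field_simp
  calc U ^ (d + 1) ≤ (((d : ℝ) + 1) / (Real.exp 1 * p) * Real.exp (p * U / (d + 1))) ^ (d + 1) := by
        gcongr
    _ = _ := by
      rw [mul_pow, ← Real.exp_nat_mul]
      congr 2
      push_cast
      field_simp

end AnisotropicGaussian

end

theorem mainTheorem5 (d : ℕ) (c : EuclideanSpace ℝ (Fin d)) (r : ℝ) (hr : 0 < r) :
    ∃ K : ℝ, 0 < K ∧
      ∀ p : ℝ, 0 < p → p < 1 →
      ∀ γ : Fin d → ℝ, (∀ j, 0 < γ j ∧ γ j ≤ 1) →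
      ∀ i : ℕ, 1 ≤ i →
        AnisotropicGaussian.entropyNumber
            (AnisotropicGaussian.idToLinfty γ (Metric.closedBall c r)) i ≤
          ENNReal.ofReal
            ((3 * K) ^ (1 / p) *
              (((d : ℝ) + 1) / (Real.exp 1 * p)) ^ (((d : ℝ) + 1) / p) *
              (∏ j, γ j) ^ (-(1 / p)) *
              (i : ℝ) ^ (-(1 / p))) := by
  obtain ⟨K₀, hK₀, hcover⟩ := AnisotropicGaussian.exists_entropyNumber_le c hr
  have hlog2 : 0 < Real.log 2 := Real.log_pos one_lt_two
  have he : 0 < Real.exp 1 := Real.exp_pos 1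
  -- The first summand makes the final covering estimate close (`hKK`); the second forces `A ≥ 1`,
  -- so that `i > A` implies `i ≥ 2`.
  set K : ℝ := 2 * K₀ * Real.exp 1 / (3 * Real.log 2) + Real.exp 1 ^ (d + 1) with hK
  have hK0 : 0 < K := by positivity
  refine ⟨K, hK0, fun p hp hp1 γ hγ i hi => ?_⟩
  have hΓ : 0 < ∏ j, γ j := Finset.prod_pos fun j _ => (hγ j).1
  have hΓ1 : ∏ j, γ j ≤ 1 := Finset.prod_le_one (fun j _ => (hγ j).1.le) fun j _ => (hγ j).2
  have hi0 : (0 : ℝ) < i := by exact_mod_cast hi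
  set Γ := ∏ j, γ j
  set B : ℝ := (((d : ℝ) + 1) / (Real.exp 1 * p)) ^ (d + 1) with hB
  have hB0 : 0 < B := by positivity
  set A : ℝ := 3 * K * B * Γ⁻¹ with hA
  have hA0 : 0 < A := by positivity
  have hrhs : (3 * K) ^ (1 / p) * (((d : ℝ) + 1) / (Real.exp 1 * p)) ^ (((d : ℝ) + 1) / p) *
      Γ ^ (-(1 / p)) * (i : ℝ) ^ (-(1 / p)) = (A / i) ^ (1 / p) := by
    have h1 : (((d : ℝ) + 1) / (Real.exp 1 * p)) ^ (((d : ℝ) + 1) / p) = B ^ (1 / p) := by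
      rw [hB, ← Real.rpow_natCast, ← Real.rpow_mul (by positivity)]
      congr 1
      push_cast
      ring
    rw [h1, Real.rpow_neg hΓ.le, Real.rpow_neg hi0.le, ← Real.inv_rpow hΓ.le,
      ← Real.inv_rpow hi0.le, ← Real.mul_rpow (by positivity) hB0.le,
      ← Real.mul_rpow (by positivity) (by positivity),
      ← Real.mul_rpow (by positivity) (by positivity), ← div_eq_mul_inv]
  rw [hrhs]
  rcases le_or_gt (i : ℝ) A with hiA | hiA
  · refine (AnisotropicGaussian.entropyNumber_le_one γ _ i).trans ?_
    rw [← ENNReal.ofReal_one]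
    exact ENNReal.ofReal_le_ofReal
      (Real.one_le_rpow ((one_le_div hi0).2 hiA) (by positivity))
  have hA1 : 1 ≤ A := by
    have h1 : (Real.exp 1)⁻¹ ^ (d + 1) ≤ B := by
      rw [hB]
      gcongr
      rw [div_mul_eq_div_div_swap, inv_eq_one_div]
      gcongr
      rw [one_le_div hp]
      linarith [(Nat.cast_nonneg d : (0 : ℝ) ≤ d)]
    have h2 : Real.exp 1 ^ (d + 1) ≤ K := le_add_of_nonneg_left (by positivity)
    have h3 : 1 ≤ K * B := by
      calc 1 = Real.exp 1 ^ (d + 1) * (Real.exp 1)⁻¹ ^ (d + 1) := by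
            rw [← mul_pow, mul_inv_cancel₀ he.ne', one_pow]
        _ ≤ K * B := by gcongr
    have h4 : 1 ≤ Γ⁻¹ := (one_le_inv₀ hΓ).2 hΓ1
    calc (1 : ℝ) ≤ 3 * (K * B) * 1 := by linarith
      _ ≤ 3 * (K * B) * Γ⁻¹ := by gcongr
      _ = A := by rw [hA]; ring
  have hi2 : 2 ≤ i := by
    have : (1 : ℝ) < i := hA1.trans_lt hiA
    exact_mod_cast this
  have hAi : 0 < A / i := by positivity
  have hAi1 : A / i ≤ 1 := (div_le_one hi0).2 hiA.le
  refine hcover γ hγ _ (Real.rpow_pos_of_pos hAi _)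
    (Real.rpow_le_one hAi.le hAi1 (by positivity)) i ?_
  rw [Real.log_inv, Real.log_rpow hAi]
  set U : ℝ := 1 + -(1 / p * Real.log (A / i)) with hU
  have hU0 : 0 ≤ U := by
    have h1 := Real.log_nonpos hAi.le hAi1
    have h2 : 1 / p * Real.log (A / i) ≤ 0 := mul_nonpos_of_nonneg_of_nonpos (by positivity) h1
    linarith
  have hexp : Real.exp (p * U) ≤ Real.exp 1 * (i / A) := by
    have h1 : p * U = p + -Real.log (A / i) := by rw [hU]; field_simp
    rw [h1, Real.exp_add, Real.exp_neg, Real.exp_log hAi, inv_div]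
    gcongr
  have hpow := AnisotropicGaussian.pow_le_mul_exp hp hU0 d
  have hKK : K₀ * Real.exp 1 / (3 * K) ≤ Real.log 2 / 2 := by
    rw [div_le_div_iff₀ (by positivity) two_pos]
    have h1 : 2 * K₀ * Real.exp 1 / (3 * Real.log 2) ≤ K := by
      rw [hK]; linarith [pow_pos he (d + 1)]
    rw [div_le_iff₀ (by positivity)] at h1
    linarith
  -- The dyadic shift `i - 1` costs a factor two, which `i ≥ 2` permits and the `2` in `K` absorbs.
  have hhalf : (i : ℝ) / 2 ≤ (i - 1 : ℕ) := by
    rw [Nat.cast_sub hi]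
    have : (2 : ℝ) ≤ i := by exact_mod_cast hi2
    push_cast
    linarith
  calc K₀ * Γ⁻¹ * U ^ (d + 1) ≤ K₀ * Γ⁻¹ * (B * (Real.exp 1 * (i / A))) := by
        gcongr
        exact hpow.trans (by gcongr)
    _ = K₀ * Real.exp 1 / (3 * K) * i := by
        rw [hA]; field_simp
    _ ≤ Real.log 2 / 2 * i := by gcongr
    _ = i / 2 * Real.log 2 := by ring
    _ ≤ (i - 1 : ℕ) * Real.log 2 := by gcongr
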